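/- Let $G$ be a finite nilpotent group and let $\chi\in\mathrm{Irr}(G)$ be an irreducible complex character of $G$. Let $\omega(\chi)$ denote the number of primes $p$ dividing $\chi(1)$. Then \[ \frac{|\{g\in G : \chi(g)=0\}|}{|G|} \;\geq\; 1-\frac{1}{2^{\omega(\chi)}}\left(\frac{|G|-\chi(1)^2+2^{\omega(\chi)}}{|G|}\right). \] -/

import Mathlib

/-!
A finite nilpotent group is the direct product of its Sylow subgroups, and an irreducible character
of a direct product is the product of irreducible characters of the factors. An inequality
`2 ^ ω(χ) * (N - 1) ≤ |G| - χ(1) ^ 2`, with `N` the number of elements at which `χ` does not vanish,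
passes from the factors to the product, so it suffices to prove it when `G` is a `p`-group.

In that case suppose that `p ∣ χ(1)` and `χ(g) ≠ 0`. Then `χ(g) = f(ζ)` for an integer polynomial
`f` with `f(1) = χ(1)` and a root of unity `ζ` of `p`-power order. By Parseval, the squared absolute
values of the Galois conjugates of `f(ζ)` add up, in units of `[ℚ(ζ) : ℚ] / (p - 1)`, to a sum of
scaled variances of integer vectors of length `p`. The divisibility of `f(1)` by `p` forces the mean
of these squares to be at least `2`, whereas for an arbitrary nonzero algebraic integer the AM-GM
inequality only gives `1`. The conjugates of `χ(g)` are the values of `χ` at the powers `g ^ u` with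
`u` prime to `p`, so summing over `g ≠ 1` and comparing with `∑ |χ(g)| ^ 2 = |G|` gives
`2 * (N - 1) ≤ |G| - χ(1) ^ 2`.
-/

/-- `Irr G` is the set of irreducible complex characters of `G`: the functions `g ↦ tr ρ(g)` for `ρ` an
irreducible representation of `G` on a finite-dimensional complex vector space. Up to isomorphism,
which does not change the character, the space is `ℂⁿ`; the zero space is not irreducible. -/
def Irr (G : Type*) [Group G] : Set (G → ℂ) :=
  {χ | ∃ (n : ℕ) (ρ : Representation ℂ G (Fin n → ℂ)), ρ.IsIrreducible ∧ ρ.character = χ}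

/-- The value of an irreducible character at the identity is a positive integer. -/
theorem Irr.exists_degree {G : Type*} [Group G] {χ : G → ℂ} (hχ : χ ∈ Irr G) :
    ∃ d : ℕ, 0 < d ∧ χ 1 = (d : ℂ) := by
  obtain ⟨n, ρ, hρ, rfl⟩ := hχ
  refine ⟨n, Nat.pos_of_ne_zero ?_, by simp⟩
  rintro rfl
  obtain ⟨a, b, hab⟩ := hρ.toNontrivial
  apply hab
  ext x
  rw [Subsingleton.elim x 0]
  exact ⟨fun _ => b.toSubmodule.zero_mem, fun _ => a.toSubmodule.zero_mem⟩

/-- The number of primes `p` that divide the degree `χ(1)` in the integers. -/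
noncomputable def charOmega {G : Type*} [Group G] (χ : G → ℂ) : ℕ :=
  {p : ℕ | p.Prime ∧ ∃ d : ℕ, χ 1 = (d : ℂ) ∧ p ∣ d}.ncard

section ScaledVariance

open Finset

variable {ι : Type*}

/-- The variance of the integers `c i`, `i ∈ s`, scaled by the factor `#s ^ 2` so that it is an
integer. For `s` the set of residues modulo a prime `p`, it is the sum of the squared absolute
values of the conjugates of `∑ i ∈ s, c i * ω ^ i`, where `ω` is a primitive `p`-th root of
unity. -/
def scaledVariance (s : Finset ι) (c : ι → ℤ) : ℤ :=
  #s * ∑ i ∈ s, c i ^ 2 - (∑ i ∈ s, c i) ^ 2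

theorem scaledVariance_sub_const (s : Finset ι) (c : ι → ℤ) (t : ℤ) :
    scaledVariance s (fun i => c i - t) = scaledVariance s c := by
  simp only [scaledVariance, sub_sq, sum_sub_distrib, sum_add_distrib, ← mul_sum, ← sum_mul,
    sum_const, nsmul_eq_mul]
  ring

theorem scaledVariance_nonneg (s : Finset ι) (c : ι → ℤ) : 0 ≤ scaledVariance s c :=
  sub_nonneg.2 sq_sum_le_card_mul_sum_sq

theorem sum_sub_sum_ediv_card (s : Finset ι) (c : ι → ℤ) :
    ∑ i ∈ s, (c i - (∑ i ∈ s, c i) / #s) = (∑ i ∈ s, c i) % #s := by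
  rw [sum_sub_distrib, sum_const, nsmul_eq_mul, Int.emod_def]

theorem emod_mul_sub_emod_le_scaledVariance (s : Finset ι) (c : ι → ℤ) :
    (∑ i ∈ s, c i) % #s * (#s - (∑ i ∈ s, c i) % #s) ≤ scaledVariance s c := by
  rw [← scaledVariance_sub_const s c ((∑ i ∈ s, c i) / #s), scaledVariance,
    sum_sub_sum_ediv_card]
  have hle : (∑ i ∈ s, c i) % #s ≤ ∑ i ∈ s, (c i - (∑ i ∈ s, c i) / #s) ^ 2 := by
    rw [← sum_sub_sum_ediv_card]
    exact sum_le_sum fun i _ => Int.le_self_sq _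
  linarith [mul_le_mul_of_nonneg_left hle (Nat.cast_nonneg (α := ℤ) #s)]

theorem two_dvd_sum_sq_of_sum_eq_zero {s : Finset ι} {c : ι → ℤ} (h : ∑ i ∈ s, c i = 0) :
    2 ∣ ∑ i ∈ s, c i ^ 2 := by
  have hsum : ∑ i ∈ s, c i ^ 2 = ∑ i ∈ s, c i * (c i - 1) := by
    rw [← sub_eq_zero, ← sum_sub_distrib, ← h]
    exact sum_congr rfl fun i _ => by ring
  rw [hsum]
  exact dvd_sum fun i _ => (Int.even_mul_pred_self (c i)).two_dvd

theorem two_mul_card_le_scaledVariance {s : Finset ι} {c : ι → ℤ} (h : (#s : ℤ) ∣ ∑ i ∈ s, c i)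
    (h0 : scaledVariance s c ≠ 0) : 2 * (#s : ℤ) ≤ scaledVariance s c := by
  rw [← scaledVariance_sub_const s c ((∑ i ∈ s, c i) / #s)] at h0 ⊢
  have hsum := sum_sub_sum_ediv_card s c
  rw [Int.emod_eq_zero_of_dvd h] at hsum
  rw [scaledVariance, hsum, zero_pow two_ne_zero, sub_zero] at h0 ⊢
  rw [mul_comm]
  refine mul_le_mul_of_nonneg_left ?_ (Nat.cast_nonneg (α := ℤ) #s)
  exact Int.le_of_dvd ((sum_nonneg fun i _ => sq_nonneg _).lt_of_ne' (right_ne_zero_of_mul h0))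
    (two_dvd_sum_sq_of_sum_eq_zero hsum)

theorem card_sub_one_le_scaledVariance {s : Finset ι} {c : ι → ℤ} (h0 : scaledVariance s c ≠ 0) :
    (#s : ℤ) - 1 ≤ scaledVariance s c := by
  by_cases h : (#s : ℤ) ∣ ∑ i ∈ s, c i
  · linarith [two_mul_card_le_scaledVariance h h0, Nat.cast_nonneg (α := ℤ) #s]
  have hs : (0 : ℤ) < #s := by
    rw [Nat.cast_pos, card_pos, nonempty_iff_ne_empty]
    rintro rfl
    simp at h
  have hpos := Int.emod_pos_of_not_dvd h |>.resolve_left hs.ne'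
  have hlt := Int.emod_lt_of_pos (∑ i ∈ s, c i) hs
  nlinarith [emod_mul_sub_emod_le_scaledVariance s c]

theorem two_mul_sub_one_le_sum_scaledVariance {κ : Type*} {p : ℕ} (hp : p.Prime) {t : Finset κ}
    {s : κ → Finset ι} (hs : ∀ j ∈ t, #(s j) = p) {c : ι → ℤ}
    (h : (p : ℤ) ∣ ∑ j ∈ t, ∑ i ∈ s j, c i) (h0 : ∑ j ∈ t, scaledVariance (s j) c ≠ 0) :
    2 * ((p : ℤ) - 1) ≤ ∑ j ∈ t, scaledVariance (s j) c := by
  classical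
  obtain ⟨a, ha, ha0⟩ := exists_ne_zero_of_sum_ne_zero h0
  by_cases hb : ∃ b ∈ t.erase a, scaledVariance (s b) c ≠ 0
  · obtain ⟨b, hb, hb0⟩ := hb
    have hsub : ∑ j ∈ {b, a}, scaledVariance (s j) c ≤ ∑ j ∈ t, scaledVariance (s j) c :=
      sum_le_sum_of_subset_of_nonneg (by grind) fun j _ _ => scaledVariance_nonneg _ _
    have h1 := card_sub_one_le_scaledVariance ha0
    have h2 := card_sub_one_le_scaledVariance hb0
    rw [hs a ha] at h1
    rw [hs b (mem_of_mem_erase hb)] at h2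
    rw [sum_pair (ne_of_mem_erase hb)] at hsub
    linarith
  · -- The other sums over classes are divisible by `p`, hence so is the sum over the class `a`.
    push Not at hb
    have hrest : (p : ℤ) ∣ ∑ j ∈ t.erase a, ∑ i ∈ s j, c i := by
      refine dvd_sum fun j hj => ?_
      have hj0 := hb j hj
      rw [scaledVariance, hs j (mem_of_mem_erase hj), sub_eq_zero] at hj0
      exact (Nat.prime_iff_prime_int.1 hp).dvd_of_dvd_pow ⟨_, hj0.symm⟩
    rw [← add_sum_erase _ _ ha, dvd_add_left hrest, ← hs a ha] at h
    have h1 := two_mul_card_le_scaledVariance h ha0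
    have h2 := single_le_sum (fun j _ => scaledVariance_nonneg (s j) c) ha
    rw [hs a ha] at h1
    linarith

end ScaledVariance

section Parseval

open Finset ComplexConjugate

variable {n : ℕ} {ζ : ℂ}

theorem sum_pow_pow_mul_conj_pow_pow (hζ : IsPrimitiveRoot ζ n) {x y : ℕ} (hx : x < n)
    (hy : y < n) :
    ∑ u ∈ range n, (ζ ^ u) ^ x * conj ((ζ ^ u) ^ y) = if x = y then (n : ℂ) else 0 := by
  have hn : n ≠ 0 := by lia
  have hζ0 : ζ ≠ 0 := hζ.ne_zero hn
  have hconj : conj ζ = ζ⁻¹ :=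
    (Complex.inv_eq_conj (Complex.norm_eq_one_of_pow_eq_one hζ.pow_eq_one hn)).symm
  have hterm (u : ℕ) : (ζ ^ u) ^ x * conj ((ζ ^ u) ^ y) = (ζ ^ x / ζ ^ y) ^ u := by
    rw [map_pow, map_pow, hconj, div_pow, div_eq_mul_inv, pow_right_comm, inv_pow, inv_pow,
      pow_right_comm ζ u y]
  simp only [hterm]
  split_ifs with h
  · simp [h, hζ0]
  · have h1 : ζ ^ x / ζ ^ y ≠ 1 := fun h1 =>
      h (hζ.pow_inj hx hy ((div_eq_one_iff_eq (pow_ne_zero y hζ0)).1 h1))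
    rw [geom_sum_eq h1, div_pow, pow_right_comm, pow_right_comm ζ y, hζ.pow_eq_one]
    simp

theorem sum_norm_sq_sum_mul_pow_pow (hζ : IsPrimitiveRoot ζ n) (c : ℕ → ℂ) :
    ∑ u ∈ range n, ‖∑ x ∈ range n, c x * (ζ ^ u) ^ x‖ ^ 2 = n * ∑ x ∈ range n, ‖c x‖ ^ 2 := by
  apply Complex.ofReal_injective
  push_cast
  simp only [← Complex.mul_conj', map_sum, map_mul, sum_mul_sum]
  calc ∑ u ∈ range n, ∑ x ∈ range n, ∑ y ∈ range n,
        c x * (ζ ^ u) ^ x * (conj (c y) * conj ((ζ ^ u) ^ y))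
      = ∑ x ∈ range n, ∑ y ∈ range n,
          c x * conj (c y) * ∑ u ∈ range n, (ζ ^ u) ^ x * conj ((ζ ^ u) ^ y) := by
        rw [sum_comm]
        refine sum_congr rfl fun x _ => ?_
        rw [sum_comm]
        simp only [mul_sum, mul_mul_mul_comm]
    _ = ∑ x ∈ range n, ∑ y ∈ range n, if x = y then c x * conj (c y) * n else 0 := by
        refine sum_congr rfl fun x hx => sum_congr rfl fun y hy => ?_
        rw [sum_pow_pow_mul_conj_pow_pow hζ (mem_range.1 hx) (mem_range.1 hy), mul_ite, mul_zero]
    _ = n * ∑ x ∈ range n, c x * conj (c x) := by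
        rw [mul_sum]
        refine sum_congr rfl fun x hx => ?_
        rw [sum_ite_eq, if_pos hx, mul_comm]

end Parseval

section ResidueCoeff

open Finset Polynomial

/-- The coefficient of `X ^ j` in the remainder of `f` modulo `X ^ n - 1`, for `j < n`. These
integers are the Fourier coefficients of the values of `f` at the `n`-th roots of unity. -/
def residueCoeff (f : ℤ[X]) (n j : ℕ) : ℤ := ∑ x ∈ f.support with x % n = j, f.coeff x

theorem aeval_eq_sum_residueCoeff {A : Type*} [CommRing A] {n : ℕ} (hn : n ≠ 0) {η : A}
    (hη : η ^ n = 1) (f : ℤ[X]) :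
    aeval η f = ∑ j ∈ range n, (residueCoeff f n j : A) * η ^ j := by
  rw [aeval_eq_sum_range, ← sum_subset f.supp_subset_range_natDegree_succ (by simp +contextual),
    ← sum_fiberwise_of_maps_to fun x _ => mem_range.2 (Nat.mod_lt x hn.bot_lt)]
  refine sum_congr rfl fun j _ => ?_
  rw [residueCoeff, Int.cast_sum, sum_mul]
  refine sum_congr rfl fun x hx => ?_
  rw [zsmul_eq_mul, pow_eq_pow_mod x hη, (mem_filter.1 hx).2]

theorem sum_residueCoeff_of_dvd {n q : ℕ} (hn : n ≠ 0) (hq : q ∣ n) (f : ℤ[X]) (j : ℕ) :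
    ∑ i ∈ range n with i % q = j, residueCoeff f n i = residueCoeff f q j := by
  simp only [residueCoeff]
  rw [← sum_fiberwise_of_maps_to (s := {x ∈ f.support | x % q = j})
    (t := {i ∈ range n | i % q = j}) (g := (· % n))]
  · refine sum_congr rfl fun i hi => sum_congr ?_ fun _ _ => rfl
    ext x
    have := Nat.mod_mod_of_dvd x hq
    grind
  · intro x hx
    have := Nat.mod_mod_of_dvd x hq
    have := Nat.mod_lt x hn.bot_lt
    grind

theorem sum_filter_dvd_range_mul {M : Type*} [AddCommMonoid M] {p : ℕ} (hp : p ≠ 0) (q : ℕ)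
    (F : ℕ → M) : ∑ u ∈ range (p * q) with p ∣ u, F u = ∑ v ∈ range q, F (p * v) := by
  symm
  refine sum_nbij (p * ·) ?_ ?_ ?_ fun _ _ => rfl
  · intro v hv
    have hlt := Nat.mul_lt_mul_of_pos_left (mem_range.1 hv) hp.bot_lt
    exact mem_filter.2 ⟨mem_range.2 hlt, p.dvd_mul_right v⟩
  · exact (mul_right_injective₀ hp).injOn
  · intro u hu
    obtain ⟨hu, v, rfl⟩ := mem_filter.1 hu
    exact ⟨v, mem_range.2 (Nat.lt_of_mul_lt_mul_left (mem_range.1 hu)), rfl⟩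

theorem card_filter_range_mul_mod_eq (p : ℕ) {q j : ℕ} (hj : j < q) :
    #{i ∈ range (p * q) | i % q = j} = p := by
  have hq : 0 < q := by lia
  have h := Nat.count_modEq_card (p * q) hq j
  rw [Nat.count_eq_card_filter_range] at h
  simpa [Nat.ModEq, Nat.mod_eq_of_lt hj, hq.ne'] using h

theorem sum_norm_sq_aeval (f : ℤ[X]) {n : ℕ} {ζ : ℂ} (hζ : IsPrimitiveRoot ζ n) :
    ∑ u ∈ range n, ‖aeval (ζ ^ u) f‖ ^ 2 = n * ∑ j ∈ range n, (residueCoeff f n j : ℝ) ^ 2 := by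
  rcases eq_or_ne n 0 with rfl | hn
  · simp
  have hu (u : ℕ) : (ζ ^ u) ^ n = 1 := by rw [pow_right_comm, hζ.pow_eq_one, one_pow]
  simp only [aeval_eq_sum_residueCoeff hn (hu _), sum_norm_sq_sum_mul_pow_pow hζ,
    Complex.norm_intCast, sq_abs]

theorem sum_norm_sq_aeval_not_dvd (f : ℤ[X]) {p q : ℕ} (hp : p ≠ 0) (hq : q ≠ 0) {ζ : ℂ}
    (hζ : IsPrimitiveRoot ζ (p * q)) :
    ∑ u ∈ range (p * q) with ¬ p ∣ u, ‖aeval (ζ ^ u) f‖ ^ 2 =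
      q * ∑ j ∈ range q,
        (scaledVariance {i ∈ range (p * q) | i % q = j} (residueCoeff f (p * q)) : ℝ) := by
  have hζp : IsPrimitiveRoot (ζ ^ p) q := hζ.pow (Nat.mul_ne_zero hp hq).bot_lt rfl
  have hall := sum_norm_sq_aeval f hζ
  have hdvd := sum_norm_sq_aeval f hζp
  simp only [← pow_mul] at hdvd
  rw [← sum_filter_add_sum_filter_not _ (p ∣ ·),
    sum_filter_dvd_range_mul hp q fun u => ‖aeval (ζ ^ u) f‖ ^ 2, hdvd,
    ← sum_fiberwise_of_maps_to (s := range (p * q)) (t := range q) (g := (· % q))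
      fun i _ => mem_range.2 (Nat.mod_lt i hq.bot_lt)] at hall
  have hvar : ∀ j ∈ range q,
      (scaledVariance {i ∈ range (p * q) | i % q = j} (residueCoeff f (p * q)) : ℝ) =
        p * ∑ i ∈ range (p * q) with i % q = j, (residueCoeff f (p * q) i : ℝ) ^ 2 -
          (residueCoeff f q j : ℝ) ^ 2 := by
    intro j hj
    rw [scaledVariance, card_filter_range_mul_mod_eq p (mem_range.1 hj),
      sum_residueCoeff_of_dvd (Nat.mul_ne_zero hp hq) (dvd_mul_left q p)]
    push_cast
    rfl
  rw [sum_congr rfl hvar, sum_sub_distrib, ← mul_sum, mul_sub]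
  push_cast at hall
  linarith

theorem sum_residueCoeff (f : ℤ[X]) {n : ℕ} (hn : n ≠ 0) :
    ∑ j ∈ range n, residueCoeff f n j = f.eval 1 := by
  rw [← coe_aeval_eq_eval, aeval_eq_sum_residueCoeff hn (one_pow n)]
  simp only [one_pow, mul_one, Int.cast_id]

theorem two_mul_sub_one_le_sum_scaledVariance_residueCoeff {p q : ℕ} (hp : p.Prime) (hq : q ≠ 0)
    {f : ℤ[X]} (hf : (p : ℤ) ∣ f.eval 1)
    (h0 : ∑ j ∈ range q,
      scaledVariance {i ∈ range (p * q) | i % q = j} (residueCoeff f (p * q)) ≠ 0) :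
    2 * ((p : ℤ) - 1) ≤ ∑ j ∈ range q,
      scaledVariance {i ∈ range (p * q) | i % q = j} (residueCoeff f (p * q)) := by
  refine two_mul_sub_one_le_sum_scaledVariance hp
    (fun j hj => card_filter_range_mul_mod_eq p (mem_range.1 hj)) ?_ h0
  rwa [sum_fiberwise_of_maps_to fun i _ => mem_range.2 (Nat.mod_lt i hq.bot_lt),
    sum_residueCoeff f (Nat.mul_ne_zero hp.ne_zero hq)]

theorem two_mul_totient_le_sum_norm_sq_aeval_succ {p k : ℕ} (hp : p.Prime) {ζ : ℂ}
    (hζ : IsPrimitiveRoot ζ (p ^ (k + 1))) {f : ℤ[X]} (hf : (p : ℤ) ∣ f.eval 1)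
    (h0 : aeval ζ f ≠ 0) :
    2 * ((p ^ (k + 1)).totient : ℝ) ≤
      ∑ u ∈ range (p ^ (k + 1)) with (p ^ (k + 1)).Coprime u, ‖aeval (ζ ^ u) f‖ ^ 2 := by
  have hq : p ^ k ≠ 0 := pow_ne_zero k hp.ne_zero
  have hcop (u : ℕ) : (p ^ (k + 1)).Coprime u ↔ ¬ p ∣ u := by
    rw [Nat.coprime_pow_left_iff k.succ_pos, hp.coprime_iff_not_dvd]
  have hlt : 1 < p ^ (k + 1) := Nat.one_lt_pow k.succ_ne_zero hp.one_lt
  simp only [hcop, Nat.totient_prime_pow_succ hp]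
  rw [pow_succ'] at hζ hlt ⊢
  have hpos : 0 < ∑ u ∈ range (p * p ^ k) with ¬ p ∣ u, ‖aeval (ζ ^ u) f‖ ^ 2 := by
    refine sum_pos' (fun _ _ => sq_nonneg _) ⟨1, ?_, by rw [pow_one]; positivity⟩
    exact mem_filter.2 ⟨mem_range.2 hlt, hp.one_lt.not_ge ∘ Nat.le_of_dvd one_pos⟩
  rw [sum_norm_sq_aeval_not_dvd f hp.ne_zero hq hζ, ← Int.cast_sum] at hpos ⊢
  have hvar := two_mul_sub_one_le_sum_scaledVariance_residueCoeff hp hq hf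
    (Int.cast_ne_zero.1 (right_ne_zero_of_mul hpos.ne'))
  have hvar' := Int.cast_le (R := ℝ).2 hvar
  push_cast [Nat.cast_sub hp.one_le] at hvar' ⊢
  calc 2 * ((p : ℝ) ^ k * (p - 1)) = p ^ k * (2 * (p - 1)) := by ring
    _ ≤ _ := by gcongr

theorem four_le_norm_sq_aeval_one {p : ℕ} (hp : p.Prime) {f : ℤ[X]} (hf : (p : ℤ) ∣ f.eval 1)
    (h0 : aeval (1 : ℂ) f ≠ 0) : 4 ≤ ‖aeval (1 : ℂ) f‖ ^ 2 := by
  have h1 : aeval (1 : ℂ) f = (f.eval 1 : ℤ) := by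
    simpa using aeval_algebraMap_apply ℂ (1 : ℤ) f
  rw [h1, Int.cast_ne_zero] at h0
  have h2 : (2 : ℤ) ≤ |f.eval 1| :=
    (Int.ofNat_le.2 hp.two_le).trans (Int.le_of_dvd (abs_pos.2 h0) ((dvd_abs _ _).2 hf))
  have h3 : (2 : ℝ) ≤ |((f.eval 1 : ℤ) : ℝ)| := by exact_mod_cast h2
  rw [h1, Complex.norm_intCast]
  nlinarith

theorem two_mul_totient_le_sum_norm_sq_aeval {p k : ℕ} (hp : p.Prime) {ζ : ℂ}
    (hζ : IsPrimitiveRoot ζ (p ^ k)) {f : ℤ[X]} (hf : (p : ℤ) ∣ f.eval 1)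
    (h0 : aeval ζ f ≠ 0) :
    2 * ((p ^ k).totient : ℝ) ≤
      ∑ u ∈ range (p ^ k) with (p ^ k).Coprime u, ‖aeval (ζ ^ u) f‖ ^ 2 := by
  rcases k with _ | k
  · obtain rfl : ζ = 1 := by simpa using hζ.pow_eq_one
    have h4 := four_le_norm_sq_aeval_one hp hf h0
    simp only [pow_zero, Nat.totient_one, range_one, one_pow]
    rw [filter_true_of_mem (by simp), sum_singleton, Nat.cast_one]
    linarith
  · exact two_mul_totient_le_sum_norm_sq_aeval_succ hp hζ hf h0

end ResidueCoeff

section TracePow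

open Module Module.End Polynomial

variable {K V : Type*} [Field K] [AddCommGroup V] [Module K V] {T : End K V}

theorem pow_apply_of_mem_eigenspace {μ : K} {v : V} (hv : v ∈ T.eigenspace μ) (u : ℕ) :
    (T ^ u) v = μ ^ u • v := by
  rcases eq_or_ne v 0 with rfl | hv0
  · simp
  · exact HasEigenvector.pow_apply ⟨hv, hv0⟩ u

theorem trace_pow_eq_sum_finrank_eigenspace_mul_pow [FiniteDimensional K V]
    (hT : ⨆ μ, T.eigenspace μ = ⊤) (u : ℕ) :
    LinearMap.trace K V (T ^ u) =
      ∑ μ ∈ T.finite_hasEigenvalue.toFinset, finrank K (T.eigenspace μ) * μ ^ u := by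
  classical
  have hinternal := DirectSum.isInternal_submodule_of_iSupIndep_of_iSup_eq_top
    T.eigenspaces_iSupIndep hT
  have hmaps (μ : K) : Set.MapsTo (T ^ u) (T.eigenspace μ) (T.eigenspace μ) := fun v hv => by
    rw [pow_apply_of_mem_eigenspace hv]
    exact Submodule.smul_mem _ _ hv
  rw [LinearMap.trace_eq_sum_trace_restrict' hinternal T.finite_hasEigenvalue hmaps]
  refine Finset.sum_congr rfl fun μ _ => ?_
  have hscalar : (T ^ u).restrict (hmaps μ) = μ ^ u • 1 :=
    LinearMap.ext fun v => Subtype.ext (pow_apply_of_mem_eigenspace v.2 u)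
  rw [hscalar, map_smul, LinearMap.trace_one, smul_eq_mul, mul_comm]

theorem iSup_eigenspace_eq_top_of_pow_eq_one [IsAlgClosed K] [FiniteDimensional K V] {n : ℕ}
    (hn : (n : K) ≠ 0) (hT : T ^ n = 1) : ⨆ μ, T.eigenspace μ = ⊤ := by
  refine (isSemisimple_of_squarefree_aeval_eq_zero (p := X ^ n - 1) ?_ ?_).iSup_eigenspace_eq_top
  · exact (X_pow_sub_one_separable_iff.2 hn).squarefree
  · simp [hT]

theorem exists_aeval_eq_trace_pow [IsAlgClosed K] [FiniteDimensional K V] {n : ℕ} (hn : n ≠ 0)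
    (hT : T ^ n = 1) {ζ : K} (hζ : IsPrimitiveRoot ζ n) :
    ∃ f : ℤ[X], ∀ u, LinearMap.trace K V (T ^ u) = aeval (ζ ^ u) f := by
  have : NeZero n := ⟨hn⟩
  have hroot : ∀ μ, T.HasEigenvalue μ → ∃ i, ζ ^ i = μ := fun μ hμ => by
    obtain ⟨v, hv⟩ := hμ.exists_hasEigenvector
    have h1 : μ ^ n • v = (1 : K) • v := by rw [← hv.pow_apply, hT, one_smul, one_apply]
    obtain ⟨i, -, hi⟩ := hζ.eq_pow_of_pow_eq_one (smul_left_injective K hv.2 h1)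
    exact ⟨i, hi⟩
  choose! i hi using hroot
  refine ⟨∑ μ ∈ T.finite_hasEigenvalue.toFinset,
    (finrank K (T.eigenspace μ) : ℤ[X]) * X ^ i μ, fun u => ?_⟩
  rw [trace_pow_eq_sum_finrank_eigenspace_mul_pow
    (iSup_eigenspace_eq_top_of_pow_eq_one hζ.neZero'.out hT), map_sum]
  refine Finset.sum_congr rfl fun μ hμ => ?_
  rw [map_mul, map_natCast, map_pow, aeval_X, pow_right_comm,
    hi μ (T.finite_hasEigenvalue.mem_toFinset.1 hμ)]

end TracePow

section Character

open Module Polynomial Representation ComplexConjugate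

theorem exists_aeval_eq_character_pow {k G V : Type*} [Field k] [IsAlgClosed k] [Monoid G]
    [AddCommGroup V] [Module k V] [FiniteDimensional k V] (ρ : Representation k G V) {g : G}
    {n : ℕ} (hn : n ≠ 0) (hg : g ^ n = 1) {ζ : k} (hζ : IsPrimitiveRoot ζ n) :
    ∃ f : ℤ[X], ∀ u, ρ.character (g ^ u) = aeval (ζ ^ u) f := by
  obtain ⟨f, hf⟩ := exists_aeval_eq_trace_pow hn (T := ρ g) (by rw [← map_pow, hg, map_one]) hζ
  exact ⟨f, fun u => by rw [← hf, ← map_pow, character]⟩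

theorem isIntegral_character {k G V : Type*} [Field k] [IsAlgClosed k] [CharZero k] [Group G]
    [Finite G] [AddCommGroup V] [Module k V] [FiniteDimensional k V] (ρ : Representation k G V)
    (g : G) : IsIntegral ℤ (ρ.character g) := by
  have : NeZero (Nat.card G) := ⟨Nat.card_pos.ne'⟩
  obtain ⟨ζ, hζ⟩ := HasEnoughRootsOfUnity.exists_primitiveRoot k (Nat.card G)
  obtain ⟨f, hf⟩ := exists_aeval_eq_character_pow ρ Nat.card_pos.ne' (pow_card_eq_one' (x := g)) hζ
  rw [← pow_one g, hf, pow_one]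
  exact adjoin_le_integralClosure (hζ.isIntegral Nat.card_pos) (aeval_mem_adjoin_singleton ℤ ζ)

theorem character_inv {G V : Type*} [Group G] [Finite G] [AddCommGroup V] [Module ℂ V]
    [FiniteDimensional ℂ V] (ρ : Representation ℂ G V) (g : G) :
    ρ.character g⁻¹ = conj (ρ.character g) := by
  have hn : Nat.card G ≠ 0 := Nat.card_pos.ne'
  have hζ := Complex.isPrimitiveRoot_exp (Nat.card G) hn
  set ζ := Complex.exp (2 * Real.pi * Complex.I / Nat.card G)
  obtain ⟨f, hf⟩ := exists_aeval_eq_character_pow ρ hn (pow_card_eq_one' (x := g)) hζ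
  have hg : g⁻¹ = g ^ (Nat.card G - 1) := by
    rw [inv_eq_iff_mul_eq_one, mul_pow_sub_one hn, pow_card_eq_one']
  have hconj : conj ζ = ζ ^ (Nat.card G - 1) := by
    rw [← Complex.inv_eq_conj (Complex.norm_eq_one_of_pow_eq_one hζ.pow_eq_one hn)]
    exact inv_eq_of_mul_eq_one_right (by rw [mul_pow_sub_one hn, hζ.pow_eq_one])
  rw [hg, hf, ← hconj, ← pow_one g, hf, pow_one]
  exact (aeval_algHom_apply (Complex.conjAe.toAlgHom.restrictScalars ℤ) ζ f)

end Character

section Irreducible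

open Module Representation ComplexConjugate

theorem natCast_dvd_of_isIntegral_div {K : Type*} [Field K] [CharZero K] {a b : ℕ} (hb : b ≠ 0)
    (h : IsIntegral ℤ ((a : K) / b)) : b ∣ a := by
  have hq : IsIntegral ℤ ((a : ℚ) / b) := by
    rw [← isIntegral_algebraMap_iff (algebraMap ℚ K).injective]
    simpa using h
  obtain ⟨z, hz⟩ := IsIntegrallyClosed.isIntegral_iff.1 hq
  rw [eq_div_iff (Nat.cast_ne_zero.2 hb), eq_intCast] at hz
  exact Int.natCast_dvd_natCast.1 ⟨z, by rw [mul_comm]; exact_mod_cast hz.symm⟩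

section Monoid

variable {k G V : Type*} [Field k] [Monoid G] [AddCommGroup V] [Module k V]

theorem nontrivial_of_isIrreducible (ρ : Representation k G V) [ρ.IsIrreducible] :
    Nontrivial V := by
  by_contra h
  rw [not_nontrivial_iff_subsingleton] at h
  have := (Subrepresentation.toSubmodule_injective (ρ := ρ)).subsingleton
  exact not_subsingleton (Subrepresentation ρ) this

theorem natCast_finrank_ne_zero_of_isIrreducible [CharZero k] [FiniteDimensional k V]
    (ρ : Representation k G V) [ρ.IsIrreducible] : (finrank k V : k) ≠ 0 :=
  have := nontrivial_of_isIrreducible ρ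
  Nat.cast_ne_zero.2 finrank_pos.ne'

theorem card_character_ne_zero_pos [CharZero k] [Finite G] [FiniteDimensional k V]
    (ρ : Representation k G V) [ρ.IsIrreducible] : 0 < Nat.card {g // ρ.character g ≠ 0} :=
  Nat.card_pos_iff.2
    ⟨⟨1, by rw [char_one]; exact natCast_finrank_ne_zero_of_isIrreducible ρ⟩, inferInstance⟩

theorem isIrreducible_comp_mulEquiv {H : Type*} [Monoid H] (ρ : Representation k G V)
    [ρ.IsIrreducible] (e : H ≃* G) :
    IsIrreducible (ρ.comp e.toMonoidHom : Representation k H V) :=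
  let f : Subrepresentation (ρ.comp e.toMonoidHom : Representation k H V) ≃o
      Subrepresentation ρ :=
    { toFun S := ⟨S.toSubmodule, fun g v hv => by
        simpa using S.apply_mem_toSubmodule (e.symm g) hv⟩
      invFun S := ⟨S.toSubmodule, fun h _ hv => S.apply_mem_toSubmodule (e h) hv⟩
      left_inv _ := rfl
      right_inv _ := rfl
      map_rel_iff' := Iff.rfl }
  f.isSimpleOrder

theorem eq_smul_one_of_forall_commute [CharZero k] [IsAlgClosed k] [FiniteDimensional k V]
    (ρ : Representation k G V) [ρ.IsIrreducible] (T : Module.End k V)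
    (hT : ∀ g, Commute T (ρ g)) : T = (LinearMap.trace k V T / finrank k V) • 1 := by
  obtain ⟨c, hc⟩ := IsIrreducible.algebraMap_intertwiningMap_bijective_of_isAlgClosed.2
    (⟨T, fun g => (hT g).eq⟩ : IntertwiningMap ρ ρ)
  obtain rfl : c • 1 = T := congrArg IntertwiningMap.toLinearMap hc
  rw [map_smul, LinearMap.trace_one, smul_eq_mul,
    mul_div_cancel_right₀ _ (natCast_finrank_ne_zero_of_isIrreducible ρ)]

/-- The isomorphism between the lattice of subrepresentations of a subrepresentation `S` of `ρ` and
the lattice of subrepresentations of `ρ` below `S`. It identifies the irreducible subrepresentations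
of `ρ` with the atoms of its lattice of subrepresentations. -/
def subrepresentationToRepresentationOrderIso {ρ : Representation k G V} (S : Subrepresentation ρ) :
    Subrepresentation S.toRepresentation ≃o Set.Iic S where
  toFun Q := ⟨⟨Q.toSubmodule.map S.toSubmodule.subtype, by
    rintro g _ ⟨w, hw, rfl⟩
    exact ⟨_, Q.apply_mem_toSubmodule g hw, rfl⟩⟩, Submodule.map_subtype_le _ _⟩
  invFun R := ⟨R.1.toSubmodule.comap S.toSubmodule.subtype, fun g _ hv =>
    R.1.apply_mem_toSubmodule g hv⟩
  left_inv Q := Subrepresentation.toSubmodule_injective <|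
    Submodule.comap_map_eq_of_injective S.toSubmodule.injective_subtype _
  right_inv R := Subtype.ext <| Subrepresentation.toSubmodule_injective <|
    (Submodule.map_comap_subtype _ _).trans (inf_eq_right.2 R.2)
  map_rel_iff' :=
    Submodule.map_le_map_iff_of_injective S.toSubmodule.injective_subtype _ _

theorem exists_isIrreducible_toRepresentation [FiniteDimensional k V] [Nontrivial V]
    (ρ : Representation k G V) :
    ∃ S : Subrepresentation ρ, S.toRepresentation.IsIrreducible := by
  have : WellFoundedLT (Subrepresentation ρ) :=
    StrictMono.wellFoundedLT (f := Subrepresentation.toSubmodule) fun _ _ h => h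
  have hne : (⊤ : Subrepresentation ρ) ≠ ⊥ := fun h =>
    top_ne_bot (α := Submodule k V) (congrArg Subrepresentation.toSubmodule h)
  obtain ⟨S, hS, -⟩ := (IsAtomic.eq_bot_or_exists_atom_le _).resolve_left hne
  exact ⟨S, (subrepresentationToRepresentationOrderIso S).isSimpleOrder_iff.2
    (Set.isSimpleOrder_Iic_iff_isAtom.2 hS)⟩

/-- The character of `ρ` normalized to take the value `1` at the identity. For a direct product of
groups it is this ratio, rather than the character, that is multiplicative over the factors. -/
noncomputable def characterRatio (ρ : Representation k G V) (g : G) : k :=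
  ρ.character g / finrank k V

theorem characterRatio_mul_finrank [CharZero k] [FiniteDimensional k V]
    (ρ : Representation k G V) [ρ.IsIrreducible] (g : G) :
    characterRatio ρ g * finrank k V = ρ.character g :=
  div_mul_cancel₀ _ (natCast_finrank_ne_zero_of_isIrreducible ρ)

theorem characterRatio_one [CharZero k] [FiniteDimensional k V] (ρ : Representation k G V)
    [ρ.IsIrreducible] : characterRatio ρ 1 = 1 := by
  rw [characterRatio, char_one, div_self (natCast_finrank_ne_zero_of_isIrreducible ρ)]

end Monoid

section Group

variable {k G V : Type*} [Field k] [CharZero k] [IsAlgClosed k] [Group G] [AddCommGroup V]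
  [Module k V] [FiniteDimensional k V] (ρ : Representation k G V) [ρ.IsIrreducible]

theorem sum_conj_eq_characterRatio_smul_one [Fintype G] (x : G) :
    ∑ h, ρ (h * x * h⁻¹) = (Nat.card G * characterRatio ρ x) • (1 : Module.End k V) := by
  rw [eq_smul_one_of_forall_commute ρ (∑ h, ρ (h * x * h⁻¹)), map_sum, characterRatio,
    ← mul_div_assoc]
  · congr 2
    change ∑ h, ρ.character (h * x * h⁻¹) = _
    simp
  · intro g
    rw [commute_iff_eq, Finset.sum_mul, Finset.mul_sum, ← Equiv.sum_comp (Equiv.mulLeft g)]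
    refine Finset.sum_congr rfl fun h _ => ?_
    rw [← map_mul, ← map_mul]
    simp [mul_assoc]

theorem characterRatio_mul_of_forall_isConj [Finite G] {x y : G}
    (hxy : ∀ h, IsConj (x * y) (h * x * h⁻¹ * y)) :
    characterRatio ρ (x * y) = characterRatio ρ x * characterRatio ρ y := by
  have := Fintype.ofFinite G
  have hconj (h : G) : ρ.character (h * x * h⁻¹ * y) = ρ.character (x * y) := by
    obtain ⟨c, hc⟩ := isConj_iff.1 (hxy h)
    rw [← hc, char_conj]
  have htrace := congrArg (fun T => LinearMap.trace k V (T * ρ y))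
    (sum_conj_eq_characterRatio_smul_one ρ x)
  simp only [Finset.sum_mul, map_sum, ← map_mul, smul_mul_assoc, one_mul, map_smul] at htrace
  change ∑ h, ρ.character (h * x * h⁻¹ * y) = _ • ρ.character y at htrace
  simp only [hconj, Finset.sum_const, Finset.card_univ, ← Nat.card_eq_fintype_card, nsmul_eq_mul,
    smul_eq_mul] at htrace
  rw [mul_assoc] at htrace
  rw [characterRatio, mul_left_cancel₀ (Nat.cast_ne_zero.2 Nat.card_pos.ne') htrace,
    mul_div_assoc, ← characterRatio]

theorem sum_character_mul_character_inv [Fintype G] :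
    ∑ g, ρ.character g * ρ.character g⁻¹ = Nat.card G := by
  have h0 : (Nat.card G : k) ≠ 0 := Nat.cast_ne_zero.2 Nat.card_pos.ne'
  have : Invertible (Nat.card G : k) := invertibleOfNonzero h0
  have h := card_inv_mul_sum_char_mul_char_eq_finrank ρ ρ
  rwa [IsIrreducible.finrank_intertwiningMap_self, Nat.cast_one, inv_mul_eq_one₀ h0, eq_comm] at h

theorem sum_character_inv_smul_eq_smul_one [Fintype G] :
    ∑ h, ρ.character h⁻¹ • ρ h = ((Nat.card G : k) / finrank k V) • (1 : Module.End k V) := by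
  rw [eq_smul_one_of_forall_commute ρ (∑ h, ρ.character h⁻¹ • ρ h),
    ← sum_character_mul_character_inv ρ]
  · simp only [map_sum, map_smul, smul_eq_mul]
    congr 2
    exact Finset.sum_congr rfl fun h _ => mul_comm _ _
  · intro g
    rw [commute_iff_eq, Finset.sum_mul, Finset.mul_sum, ← Equiv.sum_comp (MulAut.conj g).toEquiv]
    refine Finset.sum_congr rfl fun h _ => ?_
    have hchar : ρ.character (MulAut.conj g h)⁻¹ = ρ.character h⁻¹ := by
      rw [← map_inv, MulAut.conj_apply, char_conj]
    change ρ.character (MulAut.conj g h)⁻¹ • ρ (MulAut.conj g h) * ρ g = _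
    rw [hchar, smul_mul_assoc, mul_smul_comm, ← map_mul, ← map_mul, MulAut.conj_apply,
      inv_mul_cancel_right]

include ρ in
theorem isIntegral_card_div_finrank [Finite G] :
    IsIntegral ℤ ((Nat.card G : k) / finrank k V) := by
  have := Fintype.ofFinite G
  have := nontrivial_of_isIrreducible ρ
  let R := integralClosure ℤ k
  let z : MonoidAlgebra R G :=
    ∑ h, MonoidAlgebra.single h ⟨ρ.character h⁻¹, isIntegral_character ρ _⟩
  have hz : MonoidAlgebra.lift R (Module.End k V) G ρ z =
      algebraMap k (Module.End k V) (Nat.card G / finrank k V) := by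
    rw [Algebra.algebraMap_eq_smul_one, ← sum_character_inv_smul_eq_smul_one ρ, map_sum]
    exact Finset.sum_congr rfl fun h _ => MonoidAlgebra.lift_single _ _ _
  have hint : IsIntegral R z := Algebra.IsIntegral.isIntegral z
  refine isIntegral_trans (A := R) _ ?_
  rw [← isIntegral_algebraMap_iff (FaithfulSMul.algebraMap_injective k (Module.End k V)), ← hz]
  exact hint.map _

include ρ in
theorem finrank_dvd_card_of_isIrreducible [Finite G] : finrank k V ∣ Nat.card G :=
  natCast_dvd_of_isIntegral_div
    (Nat.cast_ne_zero.1 (natCast_finrank_ne_zero_of_isIrreducible ρ))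
    (isIntegral_card_div_finrank ρ)

theorem characterRatio_toRepresentation_comp [Finite G] {P : Type*} [Group P] {f : P →* G}
    (hf : ∀ g, ∃ t, ∀ x, g * f x * g⁻¹ = f (t * x * t⁻¹)) (S : Subrepresentation (ρ.comp f))
    (hS : (finrank k S.toSubmodule : k) ≠ 0) (x : P) :
    characterRatio S.toRepresentation x = characterRatio ρ (f x) := by
  have := Fintype.ofFinite G
  choose t ht using hf
  have hsum : ∑ h : G, S.toRepresentation (t h * x * (t h)⁻¹) =
      (Nat.card G * characterRatio ρ (f x)) • 1 := by
    ext w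
    have h := congrArg (fun T : Module.End k V => T w)
      (sum_conj_eq_characterRatio_smul_one ρ (f x))
    simp only [ht] at h
    simpa [Subrepresentation.toRepresentation] using h
  have htrace := congrArg (LinearMap.trace k S.toSubmodule) hsum
  rw [map_sum, map_smul, LinearMap.trace_one] at htrace
  change ∑ h : G, S.toRepresentation.character (t h * x * (t h)⁻¹) = _ at htrace
  simp only [char_conj, Finset.sum_const, Finset.card_univ, ← Nat.card_eq_fintype_card,
    nsmul_eq_mul, smul_eq_mul] at htrace
  rw [mul_assoc] at htrace
  rw [characterRatio, div_eq_iff hS]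
  exact mul_left_cancel₀ (Nat.cast_ne_zero.2 Nat.card_pos.ne') htrace

theorem exists_isIrreducible_characterRatio_eq [Finite G] {P : Type*} [Group P] {f : P →* G}
    (hf : ∀ g, ∃ t, ∀ x, g * f x * g⁻¹ = f (t * x * t⁻¹)) :
    ∃ (W : Submodule k V) (σ : Representation k P W), σ.IsIrreducible ∧
      ∀ x, characterRatio σ x = characterRatio ρ (f x) := by
  have := nontrivial_of_isIrreducible ρ
  obtain ⟨S, hS⟩ := exists_isIrreducible_toRepresentation (ρ.comp f)
  exact ⟨S.toSubmodule, S.toRepresentation, hS, characterRatio_toRepresentation_comp ρ hf S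
    (natCast_finrank_ne_zero_of_isIrreducible S.toRepresentation)⟩

end Group

section Complex

variable {G V : Type*} [Group G] [Fintype G] [AddCommGroup V] [Module ℂ V] [FiniteDimensional ℂ V]
  (ρ : Representation ℂ G V) [ρ.IsIrreducible]

theorem sum_norm_sq_character : ∑ g, ‖ρ.character g‖ ^ 2 = Nat.card G := by
  have h := sum_character_mul_character_inv ρ
  simp only [character_inv, Complex.mul_conj'] at h
  exact_mod_cast h

theorem finrank_sq_mul_sum_norm_sq_characterRatio :
    (finrank ℂ V : ℝ) ^ 2 * ∑ g, ‖characterRatio ρ g‖ ^ 2 = Nat.card G := by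
  rw [← sum_norm_sq_character ρ, Finset.mul_sum]
  refine Finset.sum_congr rfl fun g _ => ?_
  rw [← characterRatio_mul_finrank ρ g, norm_mul, Complex.norm_natCast, mul_pow, mul_comm]

end Complex

end Irreducible

section Pi

open Module Representation Finset

variable {k ι : Type*} [Field k] [CharZero k] [IsAlgClosed k] {P : ι → Type*}
  [∀ i, Group (P i)] [∀ i, Finite (P i)] {V : Type*} [AddCommGroup V] [Module k V]
  [FiniteDimensional k V] (ρ : Representation k (∀ i, P i) V) [ρ.IsIrreducible]

theorem characterRatio_mulSingle_mul [Finite ι] [DecidableEq ι] (i : ι) (x : P i)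
    {y : ∀ i, P i} (hy : y i = 1) :
    characterRatio ρ (Pi.mulSingle i x * y) =
      characterRatio ρ (Pi.mulSingle i x) * characterRatio ρ y := by
  refine characterRatio_mul_of_forall_isConj ρ fun h =>
    isConj_iff.2 ⟨Pi.mulSingle i (h i), funext fun j => ?_⟩
  obtain rfl | hj := eq_or_ne j i
  · simp [hy]
  · simp [hj]

theorem characterRatio_eq_prod_mulSingle [Fintype ι] [DecidableEq ι] (g : ∀ i, P i) :
    characterRatio ρ g = ∏ i, characterRatio ρ (Pi.mulSingle i (g i)) := by
  have h (s : Finset ι) : characterRatio ρ (fun i => if i ∈ s then g i else 1) =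
      ∏ i ∈ s, characterRatio ρ (Pi.mulSingle i (g i)) := by
    induction s using Finset.induction_on with
    | empty =>
      simp only [notMem_empty, if_false, prod_empty]
      exact characterRatio_one ρ
    | insert i s hi ih =>
      rw [prod_insert hi, ← ih, ← characterRatio_mulSingle_mul ρ _ _ (if_neg hi)]
      congr 1
      ext j
      obtain rfl | hj := eq_or_ne j i
      · simp [hi]
      · simp [hj]
  simpa only [mem_univ, if_true] using h univ

theorem exists_isIrreducible_characterRatio_eq_prod [Fintype ι] :
    ∃ (W : ι → Submodule k V) (σ : ∀ i, Representation k (P i) (W i)),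
      (∀ i, (σ i).IsIrreducible) ∧ ∀ g, characterRatio ρ g = ∏ i, characterRatio (σ i) (g i) := by
  classical
  have hrestrict (i : ι) := exists_isIrreducible_characterRatio_eq ρ (f := MonoidHom.mulSingle P i)
    fun g => ⟨g i, fun x => funext fun j => by
      obtain rfl | hj := eq_or_ne j i
      · simp
      · simp [hj]⟩
  choose W σ hσ hratio using hrestrict
  refine ⟨W, σ, hσ, fun g => ?_⟩
  rw [characterRatio_eq_prod_mulSingle ρ]
  exact prod_congr rfl fun i _ => (hratio i (g i)).symm

end Pi

section PGroup

open Module Representation Finset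

theorem two_mul_totient_le_sum_norm_sq_character_pow {G V : Type*} [Monoid G] [AddCommGroup V]
    [Module ℂ V] [FiniteDimensional ℂ V] (ρ : Representation ℂ G V) {p k : ℕ} (hp : p.Prime)
    {g : G} (hg : g ^ p ^ k = 1) (hd : p ∣ finrank ℂ V) (h0 : ρ.character g ≠ 0) :
    2 * ((p ^ k).totient : ℝ) ≤
      ∑ u ∈ range (p ^ k) with (p ^ k).Coprime u, ‖ρ.character (g ^ u)‖ ^ 2 := by
  have hpk : p ^ k ≠ 0 := pow_ne_zero _ hp.ne_zero
  have hζ := Complex.isPrimitiveRoot_exp (p ^ k) hpk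
  obtain ⟨f, hf⟩ := exists_aeval_eq_character_pow ρ hpk hg hζ
  have heval : f.eval 1 = finrank ℂ V := by
    have h := hf 0
    rw [pow_zero, pow_zero, char_one, ← map_one (algebraMap ℤ ℂ),
      Polynomial.aeval_algebraMap_apply_eq_algebraMap_eval, eq_intCast] at h
    exact_mod_cast h.symm
  simp only [hf]
  rw [← pow_one g, hf, pow_one] at h0
  exact two_mul_totient_le_sum_norm_sq_aeval hp hζ (heval ▸ Int.natCast_dvd_natCast.2 hd) h0

theorem sum_erase_one_pow {G M : Type*} [Group G] [Fintype G] [DecidableEq G] [AddCommMonoid M]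
    {u : ℕ} (hu : (Nat.card G).Coprime u) (F : G → M) :
    ∑ g ∈ univ.erase 1, F (g ^ u) = ∑ g ∈ univ.erase 1, F g :=
  sum_equiv (powCoprime hu) (fun g => by
    rw [mem_erase, mem_erase, ← (powCoprime hu).injective.ne_iff, powCoprime_one hu]
    simp only [mem_univ]) fun _ _ => rfl

variable {G V : Type*} [Group G] [AddCommGroup V] [Module ℂ V] [FiniteDimensional ℂ V]

theorem card_filter_erase_one_character_ne_zero [Fintype G] [DecidableEq G]
    (ρ : Representation ℂ G V) [ρ.IsIrreducible] :
    (#{g ∈ univ.erase 1 | ρ.character g ≠ 0} : ℝ) = Nat.card {g // ρ.character g ≠ 0} - 1 := by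
  have hmem : (1 : G) ∈ ({g | ρ.character g ≠ 0} : Finset G) := by
    simpa using natCast_finrank_ne_zero_of_isIrreducible ρ
  rw [filter_erase, ← Nat.cast_one, eq_sub_iff_add_eq, ← Nat.cast_add, card_erase_add_one hmem,
    Nat.card_eq_fintype_card, Fintype.card_subtype]

theorem sum_erase_one_norm_sq_character [Fintype G] [DecidableEq G] (ρ : Representation ℂ G V)
    [ρ.IsIrreducible] :
    ∑ g ∈ univ.erase 1, ‖ρ.character g‖ ^ 2 = Nat.card G - (finrank ℂ V : ℝ) ^ 2 := by
  rw [sum_erase_eq_sub (mem_univ 1), sum_norm_sq_character, char_one, Complex.norm_natCast]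

theorem two_mul_card_character_ne_zero_sub_one_le [Finite G] (ρ : Representation ℂ G V)
    [ρ.IsIrreducible] {p : ℕ} (hp : p.Prime) (hG : IsPGroup p G) (hd : p ∣ finrank ℂ V) :
    2 * ((Nat.card {g // ρ.character g ≠ 0} : ℝ) - 1) ≤
      Nat.card G - (finrank ℂ V : ℝ) ^ 2 := by
  classical
  have := Fintype.ofFinite G
  have := Fact.mk hp
  obtain ⟨k, hk⟩ := IsPGroup.iff_card.1 hG
  have hφ : (0 : ℝ) < (p ^ k).totient :=
    Nat.cast_pos.2 (Nat.totient_pos.2 (pow_pos hp.pos k))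
  refine le_of_mul_le_mul_left ?_ hφ
  let U : Finset ℕ := {u ∈ range (p ^ k) | (p ^ k).Coprime u}
  calc ((p ^ k).totient : ℝ) * (2 * (Nat.card {g // ρ.character g ≠ 0} - 1))
      = ∑ g ∈ univ.erase 1 with ρ.character g ≠ 0, 2 * ((p ^ k).totient : ℝ) := by
        rw [sum_const, nsmul_eq_mul, card_filter_erase_one_character_ne_zero]
        ring
    _ ≤ ∑ g ∈ univ.erase 1 with ρ.character g ≠ 0, ∑ u ∈ U, ‖ρ.character (g ^ u)‖ ^ 2 :=
        sum_le_sum fun g hg => two_mul_totient_le_sum_norm_sq_character_pow ρ hp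
          (hk ▸ pow_card_eq_one') hd (mem_filter.1 hg).2
    _ ≤ ∑ g ∈ univ.erase 1, ∑ u ∈ U, ‖ρ.character (g ^ u)‖ ^ 2 :=
        sum_le_sum_of_subset_of_nonneg (filter_subset _ _) fun _ _ _ => by positivity
    _ = ∑ u ∈ U, ∑ g ∈ univ.erase 1, ‖ρ.character g‖ ^ 2 := by
        rw [sum_comm]
        refine sum_congr rfl fun u hu => ?_
        exact sum_erase_one_pow (hk ▸ (mem_filter.1 hu).2) fun g => ‖ρ.character g‖ ^ 2
    _ = (p ^ k).totient * (Nat.card G - (finrank ℂ V : ℝ) ^ 2) := by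
        rw [sum_const, nsmul_eq_mul, sum_erase_one_norm_sq_character, Nat.totient]

/-- The support of the character of `ρ` is small in terms of its degree: `ρ` satisfies the
inequality `2 ^ ω(χ) * (N - 1) ≤ |G| - χ(1) ^ 2`, where `N` is the number of elements at which its
character `χ` does not vanish. Unlike the bound on the proportion of zeros of `χ`, to which it is
equivalent, this form is inherited by products. -/
def HasSupportBound (ρ : Representation ℂ G V) : Prop :=
  (2 : ℝ) ^ #(finrank ℂ V).primeFactors * (Nat.card {g // ρ.character g ≠ 0} - 1) ≤
    Nat.card G - (finrank ℂ V : ℝ) ^ 2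

theorem hasSupportBound_of_isPGroup [Finite G] (ρ : Representation ℂ G V) [ρ.IsIrreducible]
    {p : ℕ} (hp : p.Prime) (hG : IsPGroup p G) : HasSupportBound ρ := by
  have := Fact.mk hp
  obtain ⟨n, hn⟩ := IsPGroup.iff_card.1 hG
  obtain ⟨k, -, hk⟩ := (Nat.dvd_prime_pow hp).1 (hn ▸ finrank_dvd_card_of_isIrreducible ρ)
  rw [HasSupportBound]
  obtain _ | k := k
  · have hle : (Nat.card {g // ρ.character g ≠ 0} : ℝ) ≤ Nat.card G :=
      Nat.cast_le.2 (Finite.card_subtype_le _)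
    simpa [hk] using hle
  · have hω : #(finrank ℂ V).primeFactors = 1 := by
      rw [hk, Nat.primeFactors_prime_pow k.succ_ne_zero hp, card_singleton]
    rw [hω, pow_one]
    exact two_mul_card_character_ne_zero_sub_one_le ρ hp hG (hk ▸ dvd_pow_self p k.succ_ne_zero)

end PGroup

section Product

open Module Representation Finset

theorem card_primeFactors_prod_le {ι : Type*} (s : Finset ι) (d : ι → ℕ) :
    #(∏ i ∈ s, d i).primeFactors ≤ ∑ i ∈ s, #(d i).primeFactors := by
  classical
  refine (card_le_card fun p hp => ?_).trans card_biUnion_le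
  obtain ⟨hprime, hdvd, hne⟩ := Nat.mem_primeFactors.1 hp
  obtain ⟨i, hi, hpi⟩ := (hprime.prime.dvd_finsetProd_iff _).1 hdvd
  exact mem_biUnion.2 ⟨i, hi, Nat.mem_primeFactors.2 ⟨hprime, hpi, prod_ne_zero_iff.1 hne i hi⟩⟩

theorem two_pow_card_primeFactors_le {d : ℕ} (hd : d ≠ 0) : 2 ^ #d.primeFactors ≤ d :=
  (pow_card_le_prod _ _ _ fun _ hp => (Nat.prime_of_mem_primeFactors hp).two_le).trans
    (Nat.le_of_dvd (Nat.pos_of_ne_zero hd) (Nat.prod_primeFactors_dvd d))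

theorem prod_mul_prod_sub_one_le {ι : Type*} (s : Finset ι) {α N A a : ι → ℝ}
    (hα : ∀ i ∈ s, 0 ≤ α i) (hN : ∀ i ∈ s, 1 ≤ N i) (ha : ∀ i ∈ s, α i ≤ a i)
    (h : ∀ i ∈ s, α i * (N i - 1) ≤ A i - a i) :
    (∏ i ∈ s, α i) * (∏ i ∈ s, N i - 1) ≤ ∏ i ∈ s, A i - ∏ i ∈ s, a i := by
  classical
  induction s using Finset.induction_on with
  | empty => simp
  | insert i s hi ih =>
    simp only [forall_mem_insert] at hα hN ha h
    have ih := ih hα.2 hN.2 ha.2 h.2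
    simp only [prod_insert hi]
    have hβ : 0 ≤ ∏ i ∈ s, α i := prod_nonneg hα.2
    have hM : 1 ≤ ∏ i ∈ s, N i := one_le_prod hN.2
    have hb : ∏ i ∈ s, α i ≤ ∏ i ∈ s, a i := prod_le_prod hα.2 ha.2
    generalize ∏ i ∈ s, α i = β at *
    generalize ∏ i ∈ s, N i = M at *
    generalize ∏ i ∈ s, A i = B at *
    generalize ∏ i ∈ s, a i = b at *
    have hx : 0 ≤ α i * (N i - 1) := mul_nonneg hα.1 (sub_nonneg.2 hN.1)
    have hy : 0 ≤ β * (M - 1) := mul_nonneg hβ (sub_nonneg.2 hM)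
    have hprod : (a i + α i * (N i - 1)) * (b + β * (M - 1)) ≤ A i * B :=
      mul_le_mul (by linarith) (by linarith) (by linarith) (by linarith)
    have hmix₁ : α i * (β * (M - 1)) ≤ a i * (β * (M - 1)) := mul_le_mul_of_nonneg_right ha.1 hy
    have hmix₂ : β * (α i * (N i - 1)) ≤ b * (α i * (N i - 1)) := mul_le_mul_of_nonneg_right hb hx
    linear_combination hprod + hmix₁ + hmix₂

theorem card_pi_prod_ne_zero {ι R : Type*} [Fintype ι] [CommMonoidWithZero R] [Nontrivial R]
    [NoZeroDivisors R] {P : ι → Type*} (f : ∀ i, P i → R) :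
    Nat.card {g : ∀ i, P i // ∏ i, f i (g i) ≠ 0} = ∏ i, Nat.card {x // f i x ≠ 0} := by
  rw [← Nat.card_pi]
  refine Nat.card_congr ((Equiv.subtypeEquivRight fun g => ?_).trans
    (Equiv.subtypePiEquivPi (p := fun i (x : P i) => f i x ≠ 0)))
  simp [prod_ne_zero_iff]

variable {ι : Type*} {P : ι → Type*} [∀ i, Group (P i)] [∀ i, Finite (P i)]
  {V : Type*} [AddCommGroup V] [Module ℂ V] (ρ : Representation ℂ (∀ i, P i) V)

theorem hasSupportBound_of_character_eq_prod [Fintype ι] {W : ι → Type*}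
    [∀ i, AddCommGroup (W i)] [∀ i, Module ℂ (W i)] [∀ i, FiniteDimensional ℂ (W i)]
    (σ : ∀ i, Representation ℂ (P i) (W i)) [∀ i, (σ i).IsIrreducible]
    (hdeg : finrank ℂ V = ∏ i, finrank ℂ (W i))
    (hχ : ∀ g, ρ.character g = ∏ i, (σ i).character (g i)) (hσ : ∀ i, HasSupportBound (σ i)) :
    HasSupportBound ρ := by
  have hpos (i : ι) : 0 < Nat.card {x // (σ i).character x ≠ 0} := card_character_ne_zero_pos (σ i)
  have hle (i : ι) : 2 ^ #(finrank ℂ (W i)).primeFactors ≤ finrank ℂ (W i) ^ 2 :=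
    (two_pow_card_primeFactors_le
      (Nat.cast_ne_zero.1 (natCast_finrank_ne_zero_of_isIrreducible (σ i)))).trans
      (Nat.le_self_pow two_ne_zero _)
  have hcard : Nat.card {g // ρ.character g ≠ 0} = ∏ i, Nat.card {x // (σ i).character x ≠ 0} := by
    simp only [hχ, card_pi_prod_ne_zero]
  have hone : (1 : ℝ) ≤ Nat.card {g // ρ.character g ≠ 0} := by
    rw [hcard]
    exact_mod_cast prod_pos fun i _ => hpos i
  calc (2 : ℝ) ^ #(finrank ℂ V).primeFactors * (Nat.card {g // ρ.character g ≠ 0} - 1)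
      ≤ 2 ^ (∑ i, #(finrank ℂ (W i)).primeFactors) * (Nat.card {g // ρ.character g ≠ 0} - 1) := by
        rw [hdeg]
        exact mul_le_mul_of_nonneg_right
          (pow_le_pow_right₀ one_le_two (card_primeFactors_prod_le _ _)) (sub_nonneg.2 hone)
    _ ≤ ∏ i, (Nat.card (P i) : ℝ) - ∏ i, (finrank ℂ (W i) : ℝ) ^ 2 := by
        rw [hcard, ← prod_pow_eq_pow_sum, Nat.cast_prod]
        exact prod_mul_prod_sub_one_le _ (fun i _ => by positivity)
          (fun i _ => Nat.one_le_cast.2 (hpos i)) (fun i _ => by exact_mod_cast hle i)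
          fun i _ => hσ i
    _ = Nat.card (∀ i, P i) - (finrank ℂ V : ℝ) ^ 2 := by
        rw [Nat.card_pi, hdeg, Nat.cast_prod, Nat.cast_prod, prod_pow]

variable [FiniteDimensional ℂ V]

theorem finrank_eq_prod_of_characterRatio_eq_prod [Fintype ι] [ρ.IsIrreducible]
    {W : ι → Type*} [∀ i, AddCommGroup (W i)] [∀ i, Module ℂ (W i)] [∀ i, FiniteDimensional ℂ (W i)]
    (σ : ∀ i, Representation ℂ (P i) (W i)) [∀ i, (σ i).IsIrreducible]
    (h : ∀ g, characterRatio ρ g = ∏ i, characterRatio (σ i) (g i)) :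
    finrank ℂ V = ∏ i, finrank ℂ (W i) := by
  classical
  have := fun i => Fintype.ofFinite (P i)
  have hsum : ∑ g, ‖characterRatio ρ g‖ ^ 2 = ∏ i, ∑ x, ‖characterRatio (σ i) x‖ ^ 2 := by
    simp only [prod_univ_sum, Fintype.piFinset_univ, h, norm_prod, prod_pow]
  have hcard : (Nat.card (∀ i, P i) : ℝ) ≠ 0 := Nat.cast_ne_zero.2 Nat.card_pos.ne'
  have hsq : (finrank ℂ V : ℝ) ^ 2 * ∑ g, ‖characterRatio ρ g‖ ^ 2 =
      (∏ i, finrank ℂ (W i) : ℕ) ^ 2 * ∑ g, ‖characterRatio ρ g‖ ^ 2 := by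
    rw [finrank_sq_mul_sum_norm_sq_characterRatio, hsum, Nat.cast_prod, ← prod_pow,
      ← prod_mul_distrib, Nat.card_pi, Nat.cast_prod]
    exact prod_congr rfl fun i _ => (finrank_sq_mul_sum_norm_sq_characterRatio (σ i)).symm
  rw [← finrank_sq_mul_sum_norm_sq_characterRatio ρ] at hcard
  have h2 := mul_right_cancel₀ (right_ne_zero_of_mul hcard) hsq
  exact_mod_cast (pow_left_inj₀ (Nat.cast_nonneg _) (Nat.cast_nonneg _) two_ne_zero).1 h2

theorem hasSupportBound_pi [Finite ι] [ρ.IsIrreducible] {p : ι → ℕ} (hp : ∀ i, (p i).Prime)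
    (hP : ∀ i, IsPGroup (p i) (P i)) : HasSupportBound ρ := by
  have := Fintype.ofFinite ι
  obtain ⟨W, σ, hσ, hratio⟩ := exists_isIrreducible_characterRatio_eq_prod ρ
  have hdeg := finrank_eq_prod_of_characterRatio_eq_prod ρ σ hratio
  refine hasSupportBound_of_character_eq_prod ρ σ hdeg (fun g => ?_)
    fun i => hasSupportBound_of_isPGroup (σ i) (hp i) (hP i)
  simp only [← characterRatio_mul_finrank, hratio, hdeg, Nat.cast_prod, prod_mul_distrib]

end Product

section Nilpotent

open Module Representation Finset

variable {G H V : Type*} [Group G] [Group H] [AddCommGroup V] [Module ℂ V]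
  (ρ : Representation ℂ G V) (e : H ≃* G)

theorem hasSupportBound_comp_mulEquiv_iff :
    HasSupportBound (ρ.comp e.toMonoidHom : Representation ℂ H V) ↔ HasSupportBound ρ := by
  have hcard : Nat.card {h // character (ρ.comp e.toMonoidHom : Representation ℂ H V) h ≠ 0} =
      Nat.card {g // ρ.character g ≠ 0} :=
    Nat.card_congr (e.toEquiv.subtypeEquiv fun _ => Iff.rfl)
  rw [HasSupportBound, HasSupportBound, hcard, Nat.card_congr e.toEquiv]

theorem nonempty_pi_sylow_mulEquiv (G : Type*) [Group G] [Finite G] [Group.IsNilpotent G] :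
    Nonempty ((∀ i : Σ p : (Nat.card G).primeFactors, Sylow p G, (i.2 : Subgroup G)) ≃* G) := by
  obtain ⟨e⟩ := ((Group.isNilpotent_of_finite_tfae (G := G)).out 0 4).1 ‹_›
  exact ⟨{
    toEquiv := (Equiv.piCurry fun (p : (Nat.card G).primeFactors) (S : Sylow p G) =>
      (S : Subgroup G)).trans e.toEquiv
    map_mul' _ _ := e.map_mul _ _ }⟩

theorem hasSupportBound_of_isNilpotent [Finite G] [Group.IsNilpotent G] [FiniteDimensional ℂ V]
    [ρ.IsIrreducible] : HasSupportBound ρ := by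
  obtain ⟨e⟩ := nonempty_pi_sylow_mulEquiv G
  have := isIrreducible_comp_mulEquiv ρ e
  exact (hasSupportBound_comp_mulEquiv_iff ρ e).1 <|
    hasSupportBound_pi _ (fun i => Nat.prime_of_mem_primeFactors i.1.2) fun i => i.2.isPGroup'

end Nilpotent

section Zeros

open Finset

theorem charOmega_eq_card_primeFactors {G : Type*} [Group G] {χ : G → ℂ} {d : ℕ} (hd : d ≠ 0)
    (h : χ 1 = d) : charOmega χ = #d.primeFactors := by
  rw [charOmega, ← Set.ncard_coe_finset]
  congr 1
  ext p
  simp only [Set.mem_ofPred_eq, mem_coe, Nat.mem_primeFactors, h, Nat.cast_inj]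
  constructor
  · rintro ⟨hp, _, rfl, hpd⟩
    exact ⟨hp, hpd, hd⟩
  · rintro ⟨hp, hpd, -⟩
    exact ⟨hp, d, rfl, hpd⟩

open Module Representation in
theorem HasSupportBound.one_sub_le_card_eq_zero_div_card {G V : Type*} [Group G] [Finite G]
    [AddCommGroup V] [Module ℂ V] {ρ : Representation ℂ G V} (h : HasSupportBound ρ) :
    1 - 1 / (2 : ℝ) ^ #(finrank ℂ V).primeFactors *
        ((Nat.card G - (finrank ℂ V : ℝ) ^ 2 + 2 ^ #(finrank ℂ V).primeFactors) / Nat.card G) ≤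
      Nat.card {g // ρ.character g = 0} / Nat.card G := by
  have hcard : (Nat.card {g // ρ.character g = 0} : ℝ) + Nat.card {g // ρ.character g ≠ 0} =
      Nat.card G := by
    classical
    rw [← Nat.cast_add, ← Nat.card_sum, Nat.card_congr (Equiv.sumCompl _)]
  have hsupport : (Nat.card {g // ρ.character g ≠ 0} : ℝ) ≤
      1 / 2 ^ #(finrank ℂ V).primeFactors *
        (Nat.card G - (finrank ℂ V : ℝ) ^ 2 + 2 ^ #(finrank ℂ V).primeFactors) := by
    rw [HasSupportBound] at h
    rw [one_div, le_inv_mul_iff₀ (by positivity)]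
    linarith
  rw [← mul_div_assoc, one_sub_div (Nat.cast_ne_zero.2 Nat.card_pos.ne')]
  gcongr
  linarith

end Zeros

theorem theorem9 {G : Type*} [Group G] [Finite G] [Group.IsNilpotent G] (χ : G → ℂ)
    (hχ : χ ∈ Irr G) :
    (Nat.card {g : G // χ g = 0} : ℝ) / (Nat.card G : ℝ) ≥
      1 - 1 / (2 : ℝ) ^ charOmega χ *
        (((Nat.card G : ℝ) - (χ 1).re ^ 2 + (2 : ℝ) ^ charOmega χ) / (Nat.card G : ℝ)) := by
  obtain ⟨n, ρ, _, rfl⟩ := hχ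
  have hd : Module.finrank ℂ (Fin n → ℂ) ≠ 0 :=
    Nat.cast_ne_zero.1 (natCast_finrank_ne_zero_of_isIrreducible ρ)
  rw [charOmega_eq_card_primeFactors hd ρ.char_one, ρ.char_one, Complex.natCast_re]
  exact (hasSupportBound_of_isNilpotent ρ).one_sub_le_card_eq_zero_div_card
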